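/- **Theorem.** Let $\lambda\ge 0$ and let $(Y_{n,i})_{n,i\ge 1}$ be independent, identically distributed random variables with $P(Y_{n,i}=y)=\frac{\lambda^{y}}{y!}e^{-\lambda}$ for $y=0,1,2,\dots$; here $Y_{n,i}$ is the number of packets (information and coded) lost in the $i$-th time slot after the $(n-1)$-st decode event, and one coded packet is sent per slot. Let $X_n\in\{0,1,2,\dots\}\cup\{\infty\}$ be the time, in slots, between the $(n-1)$-st and the $n$-th decode event, that is, $X_n=0$ if $Y_{n,1}=0$, and otherwise $$X_n=\inf\Bigl\{z\ge 1:\ \sum_{i=1}^{z}Y_{n,i}\le z\Bigr\}\qquad(\inf\emptyset=\infty).$$ Then for every $n$ $$P(X_n=0)=e^{-\lambda},\qquad P(X_n=1)=\lambda e^{-\lambda},\qquad P(X_n=x)=\frac{(x-1)^{x-2}}{x\,(x-2)!}\,\lambda^{x}e^{-x\lambda}\quad\text{for all integers } x\ge 2.$$ If moreover $\lambda<1$, then $X_n<\infty$ almost surely (so that $X_n$ takes no other value with positive probability), and its first two moments are finite and given by $$E[X_n]=\frac{\lambda}{1-\lambda}e^{-\lambda},\qquad E[X_n^2]=\frac{1-\lambda+\lambda^2}{(1-\lambda)^2}\,E[X_n].$$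 -/

import Mathlib

/-- A renewal (decode event) can take place at the end of the `z`-th slot after the previous decode
event when the total number of packets lost in those `z` slots is at most `z`, the number of coded
packets sent in them (one per slot). Here `y i` is the number of packets lost in the `(i + 1)`-st
slot, so `y 0, y 1, …` are the losses of the first, second, … slot. -/
def CanDecodeAt (y : ℕ → ℕ) (z : ℕ) : Prop :=
  ∑ i ∈ Finset.range z, y i ≤ z

/-- The time, in slots, from one decode event to the next, as a function of the losses `y 0, y 1, …`
in the successive slots after the former: it is `0` if nothing is lost in the first slot (the coded
packet is dropped), and otherwise the first `z ≥ 1` at which decoding is possible. The value is `⊤`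
if there is no such `z`. -/
noncomputable def interDecodeTime (y : ℕ → ℕ) : ℕ∞ :=
  open Classical in
  if y 0 = 0 then 0 else ⨅ (z : ℕ) (_ : 1 ≤ z ∧ CanDecodeAt y z), (z : ℕ∞)

/-! The deficit (losses minus slots) falls by at most one per slot, so decoding first becomes
possible when it equals zero exactly. After a first loss `y 0 ≠ 0`, the decode time is thus one plus
the time at which a Poisson walk started at `y 0 - 1` first hits `0`. Conditioning on one step and
using the binomial theorem gives the hitting time theorem by induction: the probability is `k / n`
times that of a Poisson(`n r`) variable being `n - k`. Averaging over the first loss gives `P(X = n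
+ 1) = a n * u ^ (n + 1)`, where `a n = n ^ n / (n + 1)!` and `u = r exp (-r)`.

For `r < 1` the strong law makes `X` finite almost surely. The masses then sum to one, so the power
series of the `a n` at `u` equals `1 - exp (-r)` on all of `(0, 1)`. Differentiating this identity
in `r` once and twice yields the two moments (`hasSum_succ_mul_of_tsum_eq`). -/

open MeasureTheory ProbabilityTheory Filter Topology

/-! ### Decode times as hitting times of a walk -/

/-- The walk `z ↦ k + y 0 + ⋯ + y (z - 1) - z` started at `k` first hits `0` at time `n`. -/
def HitsAt (k n : ℕ) (y : ℕ → ℕ) : Prop :=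
  (∀ z < n, z < k + ∑ i ∈ Finset.range z, y i) ∧ k + ∑ i ∈ Finset.range n, y i = n

theorem hitsAt_zero_right (k : ℕ) (y : ℕ → ℕ) : HitsAt k 0 y ↔ k = 0 := by
  simp [HitsAt]

theorem not_hitsAt_zero_left (n : ℕ) (y : ℕ → ℕ) : ¬ HitsAt 0 (n + 1) y := by
  intro h
  simpa using h.1 0 (Nat.succ_pos n)

theorem hitsAt_succ_succ (k n : ℕ) (y : ℕ → ℕ) :
    HitsAt (k + 1) (n + 1) y ↔ HitsAt (k + y 0) n (fun i => y (i + 1)) := by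
  simp only [HitsAt]
  rw [Finset.sum_range_succ' y n]
  refine and_congr ⟨fun h z hz => ?_, fun h z hz => ?_⟩ (by omega)
  · have := h (z + 1) (by omega)
    rw [Finset.sum_range_succ'] at this
    omega
  · cases z with
    | zero => omega
    | succ z =>
      have := h z (by omega)
      rw [Finset.sum_range_succ']
      omega

theorem HitsAt.le {k n : ℕ} {y : ℕ → ℕ} (h : HitsAt k n y) : k ≤ n := by
  have := h.2
  omega

theorem interDecodeTime_eq_zero_iff (y : ℕ → ℕ) : interDecodeTime y = 0 ↔ y 0 = 0 := by
  unfold interDecodeTime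
  split_ifs with h
  · simp [h]
  · simp only [h, iff_false]
    refine ne_of_gt (lt_of_lt_of_le (zero_lt_one) (le_iInf₂ fun z hz => ?_))
    exact_mod_cast hz.1

theorem interDecodeTime_ne_top {y : ℕ → ℕ} {z : ℕ} (hz : 1 ≤ z) (h : CanDecodeAt y z) :
    interDecodeTime y ≠ ⊤ := by
  unfold interDecodeTime
  split_ifs
  · simp
  · exact ne_top_of_le_ne_top (ENat.natCast_ne_top z) (iInf₂_le z ⟨hz, h⟩)

theorem interDecodeTime_eq_coe_iff (y : ℕ → ℕ) {x : ℕ} (hx : 1 ≤ x) :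
    interDecodeTime y = x ↔
      y 0 ≠ 0 ∧ CanDecodeAt y x ∧ ∀ z, 1 ≤ z → z < x → ¬ CanDecodeAt y z := by
  by_cases h0 : y 0 = 0
  · have := (interDecodeTime_eq_zero_iff y).2 h0
    simp only [this, h0, ne_eq, not_true_eq_false, false_and, iff_false]
    exact_mod_cast (by omega : ¬ 0 = x)
  simp only [interDecodeTime, h0, if_false, ne_eq, not_false_eq_true, true_and]
  constructor
  · intro h
    have hmin : ∀ z, 1 ≤ z → z < x → ¬ CanDecodeAt y z := by
      intro z hz hzx hc
      have : (⨅ (z : ℕ) (_ : 1 ≤ z ∧ CanDecodeAt y z), (z : ℕ∞)) ≤ z := iInf₂_le z ⟨hz, hc⟩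
      rw [h] at this
      exact absurd (by exact_mod_cast this) (not_le.2 hzx)
    refine ⟨?_, hmin⟩
    by_contra hc
    have : ((x + 1 : ℕ) : ℕ∞) ≤ ⨅ (z : ℕ) (_ : 1 ≤ z ∧ CanDecodeAt y z), (z : ℕ∞) := by
      refine le_iInf₂ fun z hz => ?_
      norm_cast
      by_contra hlt
      rcases Nat.lt_or_ge z x with h1 | h1
      · exact hmin z hz.1 h1 hz.2
      · obtain rfl : z = x := by omega
        exact hc hz.2
    rw [h] at this
    norm_cast at this
    omega
  · rintro ⟨h1, h2⟩
    refine le_antisymm (iInf₂_le x ⟨hx, h1⟩) (le_iInf₂ fun z hz => ?_)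
    norm_cast
    by_contra hlt
    exact h2 z hz.1 (by omega) hz.2

/-- The first slot contributes `y 0` losses and one coded packet, hence the start `y 0 - 1` and the
remaining time `n`. -/
theorem interDecodeTime_eq_succ_iff (y : ℕ → ℕ) (n : ℕ) :
    interDecodeTime y = (n + 1 : ℕ) ↔ y 0 ≠ 0 ∧ HitsAt (y 0 - 1) n (fun i => y (i + 1)) := by
  rw [interDecodeTime_eq_coe_iff y (by omega)]
  refine and_congr_right fun h0 => ?_
  simp only [HitsAt, CanDecodeAt]
  have key (z : ℕ) : ∑ i ∈ Finset.range (z + 1), y i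
      = y 0 - 1 + ∑ i ∈ Finset.range z, y (i + 1) + 1 := by
    rw [Finset.sum_range_succ']
    omega
  constructor
  · rintro ⟨h1, h2⟩
    have h3 : ∀ z < n, z < y 0 - 1 + ∑ i ∈ Finset.range z, y (i + 1) := by
      intro z hz
      have := h2 (z + 1) (by omega) (by omega)
      rw [key] at this
      omega
    refine ⟨h3, ?_⟩
    rw [key] at h1
    -- Positivity one step earlier and a drop of at most one turn the inequality `h1` into equality.
    cases n with
    | zero => simp at h1 ⊢; omega
    | succ m =>
      have := h3 m (by omega)
      rw [Finset.sum_range_succ] at h1 ⊢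
      omega
  · rintro ⟨h1, h2⟩
    refine ⟨by rw [key]; omega, fun z hz hzn => ?_⟩
    obtain ⟨z, rfl⟩ : ∃ w, z = w + 1 := ⟨z - 1, by omega⟩
    have := h1 z (by omega)
    rw [key]
    omega

/-! ### Closed forms for the hitting probabilities -/

/-- The probability that a walk with Poisson steps, started at `k`, first hits `0` at time `n`. -/
noncomputable def hitProb (r : ℝ) (k n : ℕ) : ℝ :=
  if n = 0 then (if k = 0 then 1 else 0) else
    if k ≤ n then
      (k : ℝ) / n * ((n : ℝ) ^ (n - k) / (n - k).factorial) * r ^ (n - k) * Real.exp (-(n * r))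
    else 0

theorem sum_pow_div_factorial (x : ℝ) (m : ℕ) :
    ∑ j ∈ Finset.range (m + 1), x ^ (m - j) / ((j.factorial : ℝ) * (m - j).factorial)
      = (x + 1) ^ m / m.factorial := by
  rw [add_comm x 1, add_pow, Finset.sum_div]
  refine Finset.sum_congr rfl fun j hj => ?_
  have hj : j ≤ m := by simpa [Nat.lt_succ_iff] using hj
  rw [Nat.cast_choose ℝ hj]
  field_simp
  simp

theorem sum_mul_pow_div_factorial (x : ℝ) (m : ℕ) :
    ∑ j ∈ Finset.range (m + 2), (j : ℝ) * (x ^ (m + 1 - j) /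
        ((j.factorial : ℝ) * (m + 1 - j).factorial))
      = (x + 1) ^ m / m.factorial := by
  rw [Finset.sum_range_succ', ← sum_pow_div_factorial]
  simp only [Nat.cast_zero, zero_mul, add_zero]
  refine Finset.sum_congr rfl fun j _ => ?_
  rw [Nat.add_sub_add_right, Nat.factorial_succ]
  push_cast
  field_simp

/-- One-step recursion: a first step `j` leads from `k + 1` to `j + k`, and only `j ≤ n - k` leaves
enough time to reach `0`. -/
theorem hitProb_succ_succ (r : ℝ) (k n : ℕ) :
    ∑ j ∈ Finset.range (n + 1 - k),
        (Real.exp (-r) * r ^ j / j.factorial) * hitProb r (j + k) n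
      = hitProb r (k + 1) (n + 1) := by
  by_cases hk : k ≤ n
  swap
  · have h0 : n + 1 - k = 0 := by omega
    have h1 : ¬ k + 1 ≤ n + 1 := by omega
    simp [hitProb, h0, hk]
  rcases Nat.eq_zero_or_pos n with rfl | hn
  · obtain rfl : k = 0 := by omega
    simp [hitProb]
  obtain ⟨m, rfl⟩ := Nat.exists_eq_add_of_le hk
  have hN : (((k + m : ℕ) : ℝ)) ≠ 0 := by exact_mod_cast hn.ne'
  set N : ℝ := ((k + m : ℕ) : ℝ) with hNdef
  have e1 : k + m + 1 - k = m + 1 := by omega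
  -- Splitting the factor `(j + k) / N` leaves one binomial sum and one weighted by `j`.
  have term : ∀ j ∈ Finset.range (m + 1),
      (Real.exp (-r) * r ^ j / j.factorial) * hitProb r (j + k) (k + m)
      = Real.exp (-((N + 1) * r)) * r ^ m / N *
        (k * (N ^ (m - j) / ((j.factorial : ℝ) * (m - j).factorial)) +
          j * (N ^ (m - j) / ((j.factorial : ℝ) * (m - j).factorial))) := by
    intro j hj
    have hj : j ≤ m := by simpa [Nat.lt_succ_iff] using hj
    have e2 : k + m - (j + k) = m - j := by omega
    have e3 : r ^ m = r ^ j * r ^ (m - j) := by rw [← pow_add]; congr 1; omega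
    have e4 : Real.exp (-((N + 1) * r)) = Real.exp (-r) * Real.exp (-(N * r)) := by
      rw [← Real.exp_add]; congr 1; ring
    rw [hitProb, if_neg hn.ne', if_pos (by omega), e2, e3, e4, ← hNdef]
    push_cast
    field_simp
    ring
  rw [e1, Finset.sum_congr rfl term, ← Finset.mul_sum, Finset.sum_add_distrib, ← Finset.mul_sum,
    sum_pow_div_factorial, hitProb, if_neg (by omega), if_pos (by omega)]
  have e5 : k + m + 1 - (k + 1) = m := by omega
  have hN1 : N + 1 ≠ 0 := by positivity
  rw [e5]
  cases m with
  | zero =>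
    have : (k : ℝ) = N := by simp [hNdef]
    simp only [this]
    push_cast
    simp [this]
    field_simp
  | succ m =>
    rw [sum_mul_pow_div_factorial, Nat.factorial_succ]
    -- With this substitution `k (N + 1) + (m + 1) = N (k + 1)`, which cancels the factor `1 / N`.
    have : (k : ℝ) = N - (m + 1) := by simp [hNdef]
    have h2 : (((k + (m + 1) + 1 : ℕ)) : ℝ) = N + 1 := by simp [hNdef]
    rw [h2]
    push_cast
    rw [this]
    field_simp
    ring

/-- Writing `j = (j + 1) - 1` gives two binomial sums lacking their zeroth terms. The full sums
cancel, and the missing term `n ^ (n + 1) / (n + 1)!` is what remains. -/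
theorem sum_hitProb_eq (r : ℝ) (n : ℕ) :
    ∑ j ∈ Finset.range (n + 1),
        (Real.exp (-r) * r ^ (j + 1) / (j + 1).factorial) * hitProb r j n
      = (n : ℝ) ^ n / (n + 1).factorial * (r * Real.exp (-r)) ^ (n + 1) := by
  have e0 : (r * Real.exp (-r)) ^ (n + 1) = r ^ (n + 1) * Real.exp (-((n + 1) * r)) := by
    rw [mul_pow, ← Real.exp_nat_mul]; push_cast; congr 2; ring
  rcases Nat.eq_zero_or_pos n with rfl | hn
  · simp [hitProb]
    ring
  have hN : (n : ℝ) ≠ 0 := by exact_mod_cast hn.ne'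
  have term : ∀ j ∈ Finset.range (n + 1),
      (Real.exp (-r) * r ^ (j + 1) / (j + 1).factorial) * hitProb r j n
      = Real.exp (-((n + 1) * r)) * r ^ (n + 1) / n *
        (((j + 1 : ℕ) : ℝ) * ((n : ℝ) ^ (n + 1 - (j + 1)) /
            (((j + 1).factorial : ℝ) * (n + 1 - (j + 1)).factorial)) -
          (n : ℝ) ^ (n + 1 - (j + 1)) /
            (((j + 1).factorial : ℝ) * (n + 1 - (j + 1)).factorial)) := by
    intro j hj
    have hj : j ≤ n := by simpa [Nat.lt_succ_iff] using hj
    have e3 : r ^ (n + 1) = r ^ (j + 1) * r ^ (n - j) := by rw [← pow_add]; congr 1; omega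
    have e4 : Real.exp (-((n + 1) * r)) = Real.exp (-r) * Real.exp (-(n * r)) := by
      rw [← Real.exp_add]; congr 1; ring
    rw [hitProb, if_neg hn.ne', if_pos hj, e3, e4, Nat.add_sub_add_right]
    push_cast
    field_simp
    ring
  have s1 := sum_mul_pow_div_factorial n n
  have s2 := sum_pow_div_factorial n (n + 1)
  rw [Finset.sum_range_succ'] at s1 s2
  rw [Finset.sum_congr rfl term, ← Finset.mul_sum, Finset.sum_sub_distrib,
    eq_sub_of_add_eq s1, eq_sub_of_add_eq s2, e0]
  simp only [Nat.factorial_succ, Nat.factorial_zero, Nat.sub_zero]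
  push_cast
  have : (n : ℝ) + 1 ≠ 0 := by positivity
  field_simp
  ring

/-! ### The law of the decode time -/

theorem measurable_sum_iSup_comap {Ω : Type*} (Z : ℕ → Ω → ℕ) (s z : ℕ) :
    Measurable[⨆ i ∈ Set.Ici s, MeasurableSpace.comap (Z i) ⊤]
      (fun ω => ∑ i ∈ Finset.range z, Z (s + i) ω) := by
  refine Finset.measurable_fun_sum _ fun i _ => ?_
  refine Measurable.mono (comap_measurable (Z (s + i))) ?_ le_rfl
  exact le_iSup₂_of_le (s + i) (Set.mem_Ici.2 (Nat.le_add_right s i)) le_rfl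

theorem measurableSet_hitsAt_iSup_comap {Ω : Type*} (Z : ℕ → Ω → ℕ) (s k n : ℕ) :
    MeasurableSet[⨆ i ∈ Set.Ici s, MeasurableSpace.comap (Z i) ⊤]
      {ω | HitsAt k n (fun i => Z (s + i) ω)} := by
  have hsum := measurable_sum_iSup_comap Z s
  have : {ω | HitsAt k n (fun i => Z (s + i) ω)} =
      (⋂ z ∈ Set.Iio n, (fun ω => ∑ i ∈ Finset.range z, Z (s + i) ω) ⁻¹' {t | z < k + t}) ∩
        (fun ω => ∑ i ∈ Finset.range n, Z (s + i) ω) ⁻¹' {t | k + t = n} := by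
    ext ω
    simp [HitsAt]
  rw [this]
  refine MeasurableSet.inter ?_ (hsum n (MeasurableSet.of_discrete))
  exact MeasurableSet.biInter (Set.to_countable _) fun z _ => hsum z MeasurableSet.of_discrete

section law

variable {Ω : Type*} [MeasurableSpace Ω] {μ : Measure Ω} {r : NNReal} {Z : ℕ → Ω → ℕ}

/-- The hitting event depends only on the coordinates from `s + 1` on, so it is independent of `Z
s`. -/
theorem measureReal_first_and_hitsAt (hZ : ∀ i, Measurable (Z i))
    (hlaw : ∀ i, HasLaw (Z i) (poissonMeasure r) μ) (hindep : iIndepFun Z μ) (s j k n : ℕ) :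
    μ.real ({ω | Z s ω = j} ∩ {ω | HitsAt k n (fun i => Z (s + 1 + i) ω)}) =
      (Real.exp (-r) * (r : ℝ) ^ j / j.factorial) *
        μ.real {ω | HitsAt k n (fun i => Z (s + 1 + i) ω)} := by
  have hdisj : Disjoint ({s} : Set ℕ) (Set.Ici (s + 1)) := by
    rw [Set.disjoint_singleton_left, Set.mem_Ici]
    omega
  have h := indep_iSup_of_disjoint (fun i => (hZ i).comap_le) hindep.iIndep hdisj
  rw [Indep_iff] at h
  have h1 : MeasurableSet[⨆ i ∈ ({s} : Set ℕ), MeasurableSpace.comap (Z i) ⊤]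
      {ω | Z s ω = j} :=
    (le_iSup₂_of_le (f := fun i (_ : i ∈ ({s} : Set ℕ)) => MeasurableSpace.comap (Z i) ⊤)
      s rfl le_rfl) _ ⟨{j}, trivial, rfl⟩
  have h2 := h _ _ h1 (measurableSet_hitsAt_iSup_comap Z (s + 1) k n)
  rw [measureReal_def, h2, ENNReal.toReal_mul, ← measureReal_def, ← measureReal_def]
  congr 1
  rw [(hlaw s).measureReal_eq (p := fun t => t = j) MeasurableSet.of_discrete,
    ← poissonMeasure_real_singleton]
  rfl

theorem measurableSet_hitsAt (hZ : ∀ i, Measurable (Z i)) (s k n : ℕ) :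
    MeasurableSet {ω | HitsAt k n (fun i => Z (s + i) ω)} := by
  have hle : (⨆ i ∈ Set.Ici s, MeasurableSpace.comap (Z i) ⊤) ≤ ‹MeasurableSpace Ω› :=
    iSup₂_le fun i _ => (hZ i).comap_le
  exact hle _ (measurableSet_hitsAt_iSup_comap Z s k n)

theorem measureReal_exists_first_and_hitsAt [IsProbabilityMeasure μ] (hZ : ∀ i, Measurable (Z i))
    (hlaw : ∀ i, HasLaw (Z i) (poissonMeasure r) μ) (hindep : iIndepFun Z μ) (s a b n N : ℕ) :
    μ.real {ω | ∃ j < N, Z s ω = j + a ∧ HitsAt (j + b) n (fun i => Z (s + 1 + i) ω)} =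
      ∑ j ∈ Finset.range N, (Real.exp (-r) * (r : ℝ) ^ (j + a) / (j + a).factorial) *
        μ.real {ω | HitsAt (j + b) n (fun i => Z (s + 1 + i) ω)} := by
  have : {ω | ∃ j < N, Z s ω = j + a ∧ HitsAt (j + b) n (fun i => Z (s + 1 + i) ω)} =
      ⋃ j ∈ Finset.range N,
        ({ω | Z s ω = j + a} ∩ {ω | HitsAt (j + b) n (fun i => Z (s + 1 + i) ω)}) := by
    ext ω
    simp [and_left_comm]
  rw [this, measureReal_biUnion_finset]
  · exact Finset.sum_congr rfl fun j _ =>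
      measureReal_first_and_hitsAt hZ hlaw hindep s (j + a) (j + b) n
  · intro i _ j _ hij
    refine Set.disjoint_left.2 fun ω hi hj => hij ?_
    have h1 : Z s ω = i + a := hi.1
    have h2 : Z s ω = j + a := hj.1
    omega
  · intro j _
    exact (hZ s (measurableSet_singleton _)).inter (measurableSet_hitsAt hZ _ _ _)

/-- The hitting time theorem for walks with Poisson steps. -/
theorem measureReal_hitsAt [IsProbabilityMeasure μ] (hZ : ∀ i, Measurable (Z i))
    (hlaw : ∀ i, HasLaw (Z i) (poissonMeasure r) μ) (hindep : iIndepFun Z μ) (n : ℕ) :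
    ∀ s k, μ.real {ω | HitsAt k n (fun i => Z (s + i) ω)} = hitProb r k n := by
  -- The shift `s` stays universally quantified because the first step passes to the sequence
  -- started at `s + 1`.
  induction n with
  | zero =>
    intro s k
    by_cases hk : k = 0 <;> simp [hitsAt_zero_right, hitProb, hk]
  | succ n ih =>
    intro s k
    cases k with
    | zero => simp [not_hitsAt_zero_left, hitProb]
    | succ k =>
      have : {ω | HitsAt (k + 1) (n + 1) (fun i => Z (s + i) ω)} =
          {ω | ∃ j < n + 1 - k, Z s ω = j + 0 ∧
            HitsAt (j + k) n (fun i => Z (s + 1 + i) ω)} := by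
        ext ω
        simp only [Set.mem_ofPred_eq, hitsAt_succ_succ, add_zero]
        have e : (fun i => Z (s + (i + 1)) ω) = fun i => Z (s + 1 + i) ω := by
          funext i; congr 1; omega
        rw [e]
        constructor
        · intro h
          have := h.le
          exact ⟨Z s ω, by omega, rfl, by rwa [add_comm]⟩
        · rintro ⟨j, _, rfl, h⟩
          rwa [add_comm] at h
      rw [this, measureReal_exists_first_and_hitsAt hZ hlaw hindep, ← hitProb_succ_succ]
      simp only [ih, add_zero]

theorem setOf_interDecodeTime_eq_succ {Ω : Type*} (Z : ℕ → Ω → ℕ) (n : ℕ) :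
    {ω | interDecodeTime (fun i => Z i ω) = (n + 1 : ℕ)} =
      {ω | ∃ j < n + 1, Z 0 ω = j + 1 ∧ HitsAt (j + 0) n (fun i => Z (0 + 1 + i) ω)} := by
  ext ω
  simp only [Set.mem_ofPred_eq, interDecodeTime_eq_succ_iff, add_zero, zero_add, add_comm 1]
  constructor
  · rintro ⟨h0, h⟩
    have := h.le
    exact ⟨Z 0 ω - 1, by omega, by omega, h⟩
  · rintro ⟨j, _, h0, h⟩
    exact ⟨by omega, by rwa [h0, Nat.add_sub_cancel]⟩

theorem measurableSet_interDecodeTime_eq (hZ : ∀ i, Measurable (Z i)) (n : ℕ) :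
    MeasurableSet {ω | interDecodeTime (fun i => Z i ω) = (n + 1 : ℕ)} := by
  rw [setOf_interDecodeTime_eq_succ, Set.ofPred_exists]
  refine MeasurableSet.iUnion fun j => ?_
  exact (MeasurableSet.const _).inter
    ((hZ 0 (measurableSet_singleton _)).inter (measurableSet_hitsAt hZ _ _ _))

theorem measureReal_interDecodeTime_eq_succ [IsProbabilityMeasure μ] (hZ : ∀ i, Measurable (Z i))
    (hlaw : ∀ i, HasLaw (Z i) (poissonMeasure r) μ) (hindep : iIndepFun Z μ) (n : ℕ) :
    μ.real {ω | interDecodeTime (fun i => Z i ω) = (n + 1 : ℕ)} =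
      (n : ℝ) ^ n / (n + 1).factorial * (r * Real.exp (-r)) ^ (n + 1) := by
  rw [setOf_interDecodeTime_eq_succ, measureReal_exists_first_and_hitsAt hZ hlaw hindep,
    ← sum_hitProb_eq]
  simp only [measureReal_hitsAt hZ hlaw hindep, add_zero]

theorem measureReal_interDecodeTime_eq_zero
    (hlaw : ∀ i, HasLaw (Z i) (poissonMeasure r) μ) :
    μ.real {ω | interDecodeTime (fun i => Z i ω) = 0} = Real.exp (-r) := by
  simp only [interDecodeTime_eq_zero_iff]
  rw [(hlaw 0).measureReal_eq (p := fun t => t = 0) MeasurableSet.of_discrete]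
  simpa using poissonMeasure_real_singleton r 0

end law

/-! ### Differentiating the power series -/

theorem summable_succ_pow_mul_geometric (k : ℕ) {q : ℝ} (hq0 : 0 < q) (hq : q < 1) :
    Summable fun n : ℕ => ((n : ℝ) + 1) ^ k * q ^ n := by
  have h := summable_pow_mul_geometric_of_norm_lt_one (R := ℝ) k
    (r := q) (by rwa [Real.norm_of_nonneg hq0.le])
  have h2 := ((summable_nat_add_iff 1).2 h).mul_right q⁻¹
  refine h2.congr fun n => ?_
  push_cast
  rw [pow_succ]
  field_simp

/-- Termwise differentiation of a power series with radius of convergence at least `exp (-1)`. -/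
theorem hasDerivAt_tsum_mul_pow_succ {a : ℕ → ℝ} {k : ℕ}
    (ha : ∀ n, |a n| ≤ ((n : ℝ) + 1) ^ k * Real.exp n) {u : ℝ} (hu : |u| < Real.exp (-1)) :
    Summable (fun n : ℕ => ((n : ℝ) + 1) * a n * u ^ n) ∧
      HasDerivAt (fun v => ∑' n, a n * v ^ (n + 1)) (∑' n : ℕ, ((n : ℝ) + 1) * a n * u ^ n) u := by
  -- On the ball of radius `ρ` the derivatives are dominated by a polynomial times a geometric
  -- series of ratio `exp 1 * ρ < 1`.
  obtain ⟨ρ, hρ1, hρ2⟩ := exists_between hu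
  have hρ0 : 0 < ρ := (abs_nonneg u).trans_lt hρ1
  have hq : Real.exp 1 * ρ < 1 := by
    calc Real.exp 1 * ρ < Real.exp 1 * Real.exp (-1) := by gcongr
      _ = 1 := by rw [← Real.exp_add]; simp
  have hs := summable_succ_pow_mul_geometric (k + 1) (by positivity) hq
  have hbound : ∀ (n : ℕ) (y : ℝ), y ∈ Metric.ball (0 : ℝ) ρ →
      ‖((n : ℝ) + 1) * a n * y ^ n‖ ≤ ((n : ℝ) + 1) ^ (k + 1) * (Real.exp 1 * ρ) ^ n := by
    intro n y hy
    have hy : |y| ≤ ρ := by simpa using (Metric.mem_ball.1 hy).le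
    rw [norm_mul, norm_mul, norm_pow, Real.norm_eq_abs, Real.norm_eq_abs, Real.norm_eq_abs,
      abs_of_nonneg (by positivity : (0 : ℝ) ≤ n + 1), mul_pow, ← Real.exp_nat_mul, mul_one]
    calc ((n : ℝ) + 1) * |a n| * |y| ^ n
        ≤ ((n : ℝ) + 1) * (((n : ℝ) + 1) ^ k * Real.exp n) * ρ ^ n := by
          gcongr
          exact ha n
      _ = _ := by ring
  have hmem : u ∈ Metric.ball (0 : ℝ) ρ := by simpa using hρ1
  refine ⟨.of_norm_bounded hs fun n => hbound n u hmem, ?_⟩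
  refine hasDerivAt_tsum_of_isPreconnected hs Metric.isOpen_ball
    (convex_ball (0 : ℝ) ρ).isPreconnected (fun n y _ => ?_) hbound
    (Metric.mem_ball_self hρ0) (by simp [summable_zero]) hmem
  have := (hasDerivAt_pow (n + 1) y).const_mul (a n)
  refine this.congr_deriv ?_
  push_cast
  ring

/-- `r exp (-r)` attains its maximum `exp (-1)` only at `r = 1`, so every `r` in `[0, 1)` gives a
point inside the disc of convergence. -/
theorem abs_mul_exp_neg_lt {r : ℝ} (h0 : 0 ≤ r) (h1 : r < 1) :
    |r * Real.exp (-r)| < Real.exp (-1) := by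
  rw [abs_of_nonneg (by positivity)]
  have h : r < Real.exp (r - 1) := by
    have := Real.add_one_lt_exp (x := r - 1) (by linarith)
    linarith
  calc r * Real.exp (-r) < Real.exp (r - 1) * Real.exp (-r) := by gcongr
    _ = Real.exp (-1) := by rw [← Real.exp_add]; ring_nf

/-- If `∑ aₙ uⁿ⁺¹ = G r` for `u = r exp (-r)` and all `r ∈ (0, 1)`, then
`∑ (n + 1) aₙ uⁿ⁺¹ = r G'(r) / (1 - r)`. -/
theorem hasSum_succ_mul_of_tsum_eq {a : ℕ → ℝ} {k : ℕ}
    (ha : ∀ n, |a n| ≤ ((n : ℝ) + 1) ^ k * Real.exp n) {G : ℝ → ℝ}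
    (hG : ∀ s, 0 < s → s < 1 → ∑' n, a n * (s * Real.exp (-s)) ^ (n + 1) = G s)
    {r G' : ℝ} (h0 : 0 < r) (h1 : r < 1) (hG' : HasDerivAt G G' r) :
    HasSum (fun n : ℕ => ((n : ℝ) + 1) * a n * (r * Real.exp (-r)) ^ (n + 1))
      (r * G' / (1 - r)) := by
  obtain ⟨hs, hd⟩ := hasDerivAt_tsum_mul_pow_succ ha (abs_mul_exp_neg_lt h0.le h1)
  have hu : HasDerivAt (fun s : ℝ => s * Real.exp (-s)) (Real.exp (-r) * (1 - r)) r := by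
    refine ((hasDerivAt_id r).mul (hasDerivAt_neg r).exp).congr_deriv ?_
    simp
    ring
  have hcomp := hd.comp r hu
  have heq : G =ᶠ[𝓝 r]
      ((fun v => ∑' n, a n * v ^ (n + 1)) ∘ fun s : ℝ => s * Real.exp (-s)) := by
    filter_upwards [Ioo_mem_nhds h0 h1] with s hs
    exact (hG s hs.1 hs.2).symm
  have hval := hG'.unique (hcomp.congr_of_eventuallyEq heq)
  have h1r : 1 - r ≠ 0 := by linarith
  -- By the chain rule the differentiated series is `G' / u'` with `u' = exp (-r) (1 - r)`;
  -- multiplying by `u` gives `r G' / (1 - r)`.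
  have := hs.hasSum.mul_right (r * Real.exp (-r))
  convert! this using 1
  · funext n
    ring
  · rw [hval]
    field_simp

theorem abs_pow_self_div_factorial_le (n : ℕ) :
    |(n : ℝ) ^ n / (n + 1).factorial| ≤ ((n : ℝ) + 1) ^ 0 * Real.exp n := by
  rw [abs_of_nonneg (by positivity), pow_zero, one_mul]
  refine le_trans ?_ (Real.pow_div_factorial_le_exp _ (Nat.cast_nonneg n) n)
  gcongr
  exact Nat.le_succ n

/-! ### Almost sure finiteness and total mass -/

theorem hasSum_poisson_mean (r : NNReal) :
    HasSum (fun n : ℕ => Real.exp (-r) * (r : ℝ) ^ n / n.factorial * n) r := by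
  rw [← hasSum_nat_add_iff' 1]
  have := (hasSum_one_poissonMeasure r).mul_left (r : ℝ)
  rw [mul_one] at this
  simp only [Finset.range_one, Finset.sum_singleton, Nat.cast_zero, mul_zero, sub_zero]
  convert! this using 2 with n
  rw [Nat.factorial_succ]
  push_cast
  field_simp
  ring

section moments

variable {Ω : Type*} [MeasurableSpace Ω] {μ : Measure Ω} {r : NNReal} {Z : ℕ → Ω → ℕ}

theorem ae_interDecodeTime_ne_top (hlaw : ∀ i, HasLaw (Z i) (poissonMeasure r) μ)
    (hindep : iIndepFun Z μ) (hr : r < 1) :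
    ∀ᵐ ω ∂μ, interDecodeTime (fun i => Z i ω) ≠ ⊤ := by
  have hint' : Integrable (fun n : ℕ => (n : ℝ)) (poissonMeasure r) := by
    rw [integrable_poissonMeasure_iff]
    simpa using (hasSum_poisson_mean r).summable
  have hint : Integrable (fun ω => (Z 0 ω : ℝ)) μ := by
    have h := hint'
    rw [← (hlaw 0).map_eq] at h
    exact h.comp_aemeasurable (hlaw 0).aemeasurable
  have hmean : ∫ ω, (Z 0 ω : ℝ) ∂μ = r := by
    have h := (hlaw 0).integral_comp (f := fun n : ℕ => (n : ℝ)) (by fun_prop)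
    have h' := (hasSum_integral_poissonMeasure hint').unique (hasSum_poisson_mean r)
    rw [← h', ← h]
    rfl
  have hslln := strong_law_ae_real (fun i ω => (Z i ω : ℝ)) hint
    (fun i j hij => (hindep.indepFun hij).comp (φ := fun n : ℕ => (n : ℝ))
      (ψ := fun n : ℕ => (n : ℝ)) (by fun_prop) (by fun_prop))
    (fun i => ((hlaw i).identDistrib (hlaw 0)).comp (u := fun n : ℕ => (n : ℝ)) (by fun_prop))
  filter_upwards [hslln] with ω hω
  have hr' : ∫ ω, (Z 0 ω : ℝ) ∂μ < 1 := by rw [hmean]; exact_mod_cast hr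
  -- The average loss tends to `r < 1`, so at some `z ≥ 1` the total loss is below `z`.
  obtain ⟨z, hz, hz1⟩ := ((hω.eventually_lt_const hr').and (eventually_ge_atTop 1)).exists
  refine interDecodeTime_ne_top hz1 ?_
  have hz0 : (0 : ℝ) < z := by exact_mod_cast hz1
  rw [div_lt_one hz0] at hz
  unfold CanDecodeAt
  exact_mod_cast hz.le

/-- A general `g` vanishing at `0` covers the total mass off `0` and both moments at once. -/
theorem lintegral_comp_interDecodeTime [IsProbabilityMeasure μ]
    (hZ : ∀ i, Measurable (Z i))
    (hlaw : ∀ i, HasLaw (Z i) (poissonMeasure r) μ)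
    (hindep : iIndepFun Z μ) (hr : r < 1) (g : ℕ∞ → ENNReal) (hg : g 0 = 0) :
    ∫⁻ ω, g (interDecodeTime (fun i => Z i ω)) ∂μ =
      ∑' n : ℕ, g (n + 1 : ℕ) * ENNReal.ofReal
        ((n : ℝ) ^ n / (n + 1).factorial * (r * Real.exp (-r)) ^ (n + 1)) := by
  have hae : ∀ᵐ ω ∂μ, g (interDecodeTime (fun i => Z i ω)) =
      ∑' n : ℕ, Set.indicator {ω | interDecodeTime (fun i => Z i ω) = (n + 1 : ℕ)}
        (fun _ => g (n + 1 : ℕ)) ω := by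
    filter_upwards [ae_interDecodeTime_ne_top hlaw hindep hr] with ω hω
    obtain ⟨x, hx⟩ := ENat.ne_top_iff_exists.1 hω
    simp only [Set.indicator, Set.mem_ofPred_eq, ← hx, Nat.cast_inj]
    cases x with
    | zero => simp [hg]
    | succ x =>
      rw [tsum_eq_single x]
      · simp
      · intro y hy
        rw [if_neg (by omega)]
  rw [lintegral_congr_ae hae, lintegral_tsum]
  · refine tsum_congr fun n => ?_
    rw [lintegral_indicator_const (measurableSet_interDecodeTime_eq hZ n),
      ← measureReal_interDecodeTime_eq_succ hZ hlaw hindep, ofReal_measureReal]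
  · exact fun n => (measurable_const.indicator (measurableSet_interDecodeTime_eq hZ n)).aemeasurable

theorem tsum_interDecodeTime_law [IsProbabilityMeasure μ]
    (hZ : ∀ i, Measurable (Z i))
    (hlaw : ∀ i, HasLaw (Z i) (poissonMeasure r) μ)
    (hindep : iIndepFun Z μ) (hr : r < 1) :
    ∑' n : ℕ, (n : ℝ) ^ n / (n + 1).factorial * ((r : ℝ) * Real.exp (-r)) ^ (n + 1)
      = 1 - Real.exp (-r) := by
  have h := lintegral_comp_interDecodeTime hZ hlaw hindep hr
    (fun x => if x = 0 then 0 else 1) (by simp)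
  have hs : MeasurableSet {ω | interDecodeTime (fun i => Z i ω) = 0} := by
    simp only [interDecodeTime_eq_zero_iff]
    exact hZ 0 (measurableSet_singleton 0)
  have hl : ∫⁻ ω, (if interDecodeTime (fun i => Z i ω) = 0 then (0 : ENNReal) else 1) ∂μ
      = ENNReal.ofReal (1 - Real.exp (-r)) := by
    have : ∀ ω, (if interDecodeTime (fun i => Z i ω) = 0 then (0 : ENNReal) else 1) =
        Set.indicator {ω | interDecodeTime (fun i => Z i ω) = 0}ᶜ (fun _ => 1) ω := by
      intro ω
      by_cases h : interDecodeTime (fun i => Z i ω) = 0 <;> simp [h]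
    rw [lintegral_congr this, lintegral_indicator_const hs.compl, one_mul, ← ofReal_measureReal,
      probReal_compl_eq_one_sub hs, measureReal_interDecodeTime_eq_zero hlaw]
  rw [hl] at h
  have hpos : ∀ n : ℕ,
      0 ≤ (n : ℝ) ^ n / (n + 1).factorial * ((r : ℝ) * Real.exp (-r)) ^ (n + 1) :=
    fun n => by positivity
  have h' := congrArg ENNReal.toReal h
  rw [ENNReal.toReal_ofReal (by simp), ENNReal.tsum_toReal_eq (by simp)] at h'
  rw [h']
  refine tsum_congr fun n => ?_
  simp [ENNReal.toReal_ofReal (hpos n)]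

end moments

/-! ### The two moments -/

/-- The identity is needed for all `s` in `(0, 1)` in order to differentiate in `s`; for each one an
infinite product of Poisson measures supplies a model. -/
theorem tsum_pow_self_div_factorial {s : ℝ} (h0 : 0 < s) (h1 : s < 1) :
    ∑' n : ℕ, (n : ℝ) ^ n / (n + 1).factorial * (s * Real.exp (-s)) ^ (n + 1)
      = 1 - Real.exp (-s) := by
  lift s to NNReal using h0.le
  exact tsum_interDecodeTime_law (r := s)
    (μ := Measure.infinitePi fun _ : ℕ => poissonMeasure s) (Z := fun i ω => ω i)
    (fun i => measurable_pi_apply i)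
    (fun i => ⟨(measurable_pi_apply i).aemeasurable, Measure.infinitePi_map_eval _ i⟩)
    (iIndepFun_infinitePi (X := fun _ => id) (fun _ => measurable_id)) (by exact_mod_cast h1)

theorem hasSum_first_moment {s : ℝ} (h0 : 0 ≤ s) (h1 : s < 1) :
    HasSum (fun n : ℕ => ((n : ℝ) + 1) * ((n : ℝ) ^ n / (n + 1).factorial) *
      (s * Real.exp (-s)) ^ (n + 1)) (s / (1 - s) * Real.exp (-s)) := by
  -- The differentiated identity lives on the open interval, so `s = 0` is separate; every term
  -- vanishes there.
  rcases h0.eq_or_lt with rfl | h0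
  · simp
  have hd : HasDerivAt (fun s : ℝ => 1 - Real.exp (-s)) (Real.exp (-s)) s := by
    simpa using (hasDerivAt_neg s).exp.const_sub 1
  have := hasSum_succ_mul_of_tsum_eq abs_pow_self_div_factorial_le
    (fun s => tsum_pow_self_div_factorial) h0 h1 hd
  convert! this using 1
  ring

theorem hasSum_second_moment {s : ℝ} (h0 : 0 ≤ s) (h1 : s < 1) :
    HasSum (fun n : ℕ => ((n : ℝ) + 1) * (((n : ℝ) + 1) * ((n : ℝ) ^ n / (n + 1).factorial)) *
      (s * Real.exp (-s)) ^ (n + 1))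
      ((1 - s + s ^ 2) / (1 - s) ^ 2 * (s / (1 - s) * Real.exp (-s))) := by
  rcases h0.eq_or_lt with rfl | h0
  · simp
  have h1s : 1 - s ≠ 0 := by linarith
  have hd : HasDerivAt (fun s : ℝ => s / (1 - s) * Real.exp (-s))
      ((1 - s + s ^ 2) / (1 - s) ^ 2 * Real.exp (-s)) s := by
    refine (((hasDerivAt_id s).div ((hasDerivAt_id s).const_sub 1) h1s).mul
      (hasDerivAt_neg s).exp).congr_deriv ?_
    simp
    field_simp
    ring
  have ha : ∀ n : ℕ, |((n : ℝ) + 1) * ((n : ℝ) ^ n / (n + 1).factorial)|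
      ≤ ((n : ℝ) + 1) ^ 1 * Real.exp n := by
    intro n
    rw [abs_mul, abs_of_nonneg (by positivity : (0 : ℝ) ≤ n + 1), pow_one]
    have := abs_pow_self_div_factorial_le n
    rw [pow_zero, one_mul] at this
    gcongr
  have := hasSum_succ_mul_of_tsum_eq ha
    (fun s h0 h1 => (hasSum_first_moment h0.le h1).tsum_eq) h0 h1 hd
  convert! this using 1
  ring

section main

variable {Ω : Type*} [MeasurableSpace Ω] {μ : Measure Ω} [IsProbabilityMeasure μ]
  {r : NNReal} {Z : ℕ → Ω → ℕ}

theorem lintegral_interDecodeTime (hZ : ∀ i, Measurable (Z i))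
    (hlaw : ∀ i, HasLaw (Z i) (poissonMeasure r) μ)
    (hindep : iIndepFun Z μ) (hr : r < 1) :
    ∫⁻ ω, ((interDecodeTime (fun i => Z i ω) : ℕ∞) : ENNReal) ∂μ =
      ENNReal.ofReal ((r : ℝ) / (1 - (r : ℝ)) * Real.exp (-(r : ℝ))) := by
  have h := hasSum_first_moment r.coe_nonneg (by exact_mod_cast hr : (r : ℝ) < 1)
  rw [lintegral_comp_interDecodeTime hZ hlaw hindep hr (fun x => (x : ENNReal)) (by simp),
    ← h.tsum_eq,
    ENNReal.ofReal_tsum_of_nonneg (fun n => by positivity) h.summable]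
  refine tsum_congr fun n => ?_
  rw [mul_assoc, ENNReal.ofReal_mul (p := (n : ℝ) + 1) (by positivity), ← Nat.cast_succ,
    ENNReal.ofReal_natCast]
  rfl

theorem lintegral_interDecodeTime_sq (hZ : ∀ i, Measurable (Z i))
    (hlaw : ∀ i, HasLaw (Z i) (poissonMeasure r) μ)
    (hindep : iIndepFun Z μ) (hr : r < 1) :
    ∫⁻ ω, ((interDecodeTime (fun i => Z i ω) : ℕ∞) : ENNReal) ^ 2 ∂μ =
      ENNReal.ofReal ((1 - (r : ℝ) + (r : ℝ) ^ 2) / (1 - (r : ℝ)) ^ 2) *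
        ∫⁻ ω, ((interDecodeTime (fun i => Z i ω) : ℕ∞) : ENNReal) ∂μ := by
  have hr1 : (r : ℝ) < 1 := by exact_mod_cast hr
  have h := hasSum_second_moment r.coe_nonneg hr1
  have hnum : 0 ≤ (1 - (r : ℝ) + (r : ℝ) ^ 2) / (1 - (r : ℝ)) ^ 2 := by
    have : 0 ≤ 1 - (r : ℝ) := by linarith
    positivity
  rw [lintegral_interDecodeTime hZ hlaw hindep hr, ← ENNReal.ofReal_mul hnum,
    lintegral_comp_interDecodeTime hZ hlaw hindep hr (fun x => (x : ENNReal) ^ 2) (by simp),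
    ← h.tsum_eq,
    ENNReal.ofReal_tsum_of_nonneg (fun n => by positivity) h.summable]
  refine tsum_congr fun n => ?_
  rw [← mul_assoc, mul_assoc, ← sq,
    ENNReal.ofReal_mul (p := ((n : ℝ) + 1) ^ 2) (by positivity), ← Nat.cast_succ,
    ENNReal.ofReal_pow (by positivity), ENNReal.ofReal_natCast]
  rfl

end main

/-! ### Assembling the theorem -/

open MeasureTheory ProbabilityTheory in
theorem mainTheorem2 {Ω : Type*} [MeasurableSpace Ω] (μ : Measure Ω) [IsProbabilityMeasure μ]
    (lam : NNReal)
    -- `Y n i` is the number of packets lost in the `(i + 1)`-st slot of the `n`-th epoch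
    (Y : ℕ → ℕ → Ω → ℕ)
    (hlaw : ∀ n i, HasLaw (Y n i) (poissonMeasure lam) μ)
    (hindep : iIndepFun (fun p : ℕ × ℕ => Y p.1 p.2) μ)
    -- `X n` is the time between decode events in the `n`-th epoch
    (X : ℕ → Ω → ℕ∞)
    (hX : ∀ n ω, X n ω = interDecodeTime (fun i => Y n i ω)) :
    (∀ n,
      μ {ω | X n ω = 0} = ENNReal.ofReal (Real.exp (-(lam : ℝ))) ∧
      μ {ω | X n ω = 1} = ENNReal.ofReal ((lam : ℝ) * Real.exp (-(lam : ℝ))) ∧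
      ∀ x : ℕ, 2 ≤ x →
        μ {ω | X n ω = (x : ℕ∞)} =
          ENNReal.ofReal (((x : ℝ) - 1) ^ (x - 2) / ((x : ℝ) * (Nat.factorial (x - 2) : ℝ)) *
            (lam : ℝ) ^ x * Real.exp (-((x : ℝ) * (lam : ℝ))))) ∧
    (lam < 1 → ∀ n,
      (∀ᵐ ω ∂μ, X n ω ≠ ⊤) ∧
      ∫⁻ ω, ((X n ω : ℕ∞) : ENNReal) ∂μ =
        ENNReal.ofReal ((lam : ℝ) / (1 - (lam : ℝ)) * Real.exp (-(lam : ℝ))) ∧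
      ∫⁻ ω, ((X n ω : ℕ∞) : ENNReal) ^ 2 ∂μ =
        ENNReal.ofReal ((1 - (lam : ℝ) + (lam : ℝ) ^ 2) / (1 - (lam : ℝ)) ^ 2) *
          ∫⁻ ω, ((X n ω : ℕ∞) : ENNReal) ∂μ) := by
  -- `HasLaw` gives only almost everywhere measurability, so each epoch is replaced by measurable
  -- versions, which changes `X n` on a null set only.
  have hmk : ∀ n, ∃ Z : ℕ → Ω → ℕ, (∀ i, Measurable (Z i)) ∧
      (∀ i, HasLaw (Z i) (poissonMeasure lam) μ) ∧ iIndepFun Z μ ∧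
      X n =ᵐ[μ] fun ω => interDecodeTime (fun i => Z i ω) := by
    intro n
    have hm := fun i => (hlaw n i).aemeasurable
    refine ⟨fun i => (hm i).mk, fun i => (hm i).measurable_mk, fun i => ?_, ?_, ?_⟩
    · exact (hlaw n i).congr (hm i).ae_eq_mk.symm
    · have h : iIndepFun (fun i => Y n i) μ :=
        hindep.precomp (g := fun i : ℕ => (n, i)) (fun i j h => by simpa using h)
      exact h.congr fun i => (hm i).ae_eq_mk
    · filter_upwards [ae_all_iff.2 fun i => (hm i).ae_eq_mk] with ω hω
      simp only [hX, hω]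
  have hmeas : ∀ {f g : Ω → ℕ∞}, f =ᵐ[μ] g → ∀ x, μ {ω | f ω = x} = μ {ω | g ω = x} := by
    intro f g h x
    refine measure_congr ?_
    filter_upwards [h] with ω hω
    exact congrArg (· = x) hω
  refine ⟨fun n => ?_, fun hlam n => ?_⟩
  · obtain ⟨Z, hZ, hZlaw, hZind, hXZ⟩ := hmk n
    refine ⟨?_, ?_, fun x hx => ?_⟩
    · rw [hmeas hXZ, ← ofReal_measureReal, measureReal_interDecodeTime_eq_zero hZlaw]
    · have h := measureReal_interDecodeTime_eq_succ hZ hZlaw hZind 0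
      rw [hmeas hXZ, ← ofReal_measureReal]
      simp only [zero_add, Nat.cast_one] at h
      rw [h]
      simp
    · obtain ⟨m, rfl⟩ := Nat.exists_eq_add_of_le' hx
      rw [hmeas hXZ, ← ofReal_measureReal,
        measureReal_interDecodeTime_eq_succ hZ hZlaw hZind (m + 1), mul_pow, ← Real.exp_nat_mul]
      congr 1
      rw [Nat.add_sub_cancel, Nat.factorial_succ, Nat.factorial_succ,
        show ((m + 1 + 1 : ℕ) : ℝ) * -(lam : ℝ) = -(((m + 2 : ℕ) : ℝ) * lam) by push_cast; ring]
      push_cast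
      rw [show (m : ℝ) + 2 - 1 = m + 1 by ring, show (m : ℝ) + 1 + 1 = m + 2 by ring]
      field_simp
      ring
  · obtain ⟨Z, hZ, hZlaw, hZind, hXZ⟩ := hmk n
    have h1 : ∫⁻ ω, ((X n ω : ℕ∞) : ENNReal) ∂μ =
        ∫⁻ ω, ((interDecodeTime (fun i => Z i ω) : ℕ∞) : ENNReal) ∂μ :=
      lintegral_congr_ae (hXZ.fun_comp fun x : ℕ∞ => (x : ENNReal))
    have h2 : ∫⁻ ω, ((X n ω : ℕ∞) : ENNReal) ^ 2 ∂μ =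
        ∫⁻ ω, ((interDecodeTime (fun i => Z i ω) : ℕ∞) : ENNReal) ^ 2 ∂μ :=
      lintegral_congr_ae (hXZ.fun_comp fun x : ℕ∞ => (x : ENNReal) ^ 2)
    rw [h1, h2]
    refine ⟨?_, lintegral_interDecodeTime hZ hZlaw hZind hlam,
      lintegral_interDecodeTime_sq hZ hZlaw hZind hlam⟩
    filter_upwards [hXZ, ae_interDecodeTime_ne_top hZlaw hZind hlam] with ω h h'
    rwa [h]
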